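/- Let $n\ge 0$. A rook of size $n$ is a word $r=r_1\dots r_n$ with letters in $\{0,1,\dots,n\}$ in which no nonzero letter is repeated; let $R_n$ be the set of rooks and $1_n=12\cdots n$. The $0$-rook monoid $R_n^0$ is the monoid of functions on $R_n$, acting on the right, generated by $\pi_0,\pi_1,\dots,\pi_{n-1}$ where $r\cdot\pi_0=0\,r_2\dots r_n$ and, for $1\le k\le n-1$, $r\cdot\pi_k$ is obtained from $r$ by exchanging $r_k$ and $r_{k+1}$ if $r_k<r_{k+1}$, and $r\cdot\pi_k=r$ otherwise. The $\mathcal R$-(pre)order on $R_n^0$ is $x\le_{\mathcal R}y\iff xR_n^0\subseteq yR_n^0$. For a rook $r$ let $\operatorname{supp}(r)$ be its set of nonzero letters, $\operatorname{Inv}(r)=\{(r_i,r_j)\mid i<j,\ r_i>r_j>0\}$, and for $\ell\in\operatorname{supp}(r)$ let $Z_r(\ell)$ be the number of $0$'s after $\ell$ in $r$ (put $Z_r(\ell)=0$ if $\ell\notin\operatorname{supp}(r)$). The triple $(\operatorname{supp}(r),\operatorname{Inv}(r),Z_r)$ is the rook triple of $r$. A set $S$ of letters is $I$-compatible if $(b,a)\in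 I$ and $b\in S$ imply $a\in S$. Then the map $R_n^0\to R_n$, $x\mapsto 1_n\cdot x$, is a bijection; write $\pi_r$ for the element with $1_n\cdot\pi_r=r$. The $\mathcal R$-preorder on $R_n^0$ is an order, and with this order $R_n^0$ is a lattice. Moreover, meets are given as follows. Let $u,v\in R_n$. - Let $I_0$ be the transitive closure of $\operatorname{Inv}(u)\cup\operatorname{Inv}(v)$. - Let $S$ be the largest (for inclusion) $I_0$-compatible set contained in $\operatorname{supp}(u)\cap\operatorname{supp}(v)$; such a largest set exists. - Let $I=I_0\cap S^2$. - For $x\in S$ let $Z(x)=\max\{Z_u(i),Z_v(i)\mid i=x\text{ or }(x,i)\in I\}$. Then $(S,I,Z)$ is the rook triple of exactly one rook $r$, and $\pi_r=\pi_u\wedge_{\mathcal R}\pi_v$. -/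

import Mathlib

/-- A rook of size `n`, as a rook vector: a word of length `n` in the letters `0, 1, …, n` in which
no nonzero letter is repeated.  Position `i : Fin n` is the `(i + 1)`-st coordinate; the letter is
the row of the unique `1` in that column of the rook matrix, or `0` if the column is zero. -/
@[ext]
structure Rook (n : ℕ) where
  letter : Fin n → ℕ
  le : ∀ i, letter i ≤ n
  inj : ∀ i j, letter i = letter j → letter i ≠ 0 → i = j

namespace Rook

variable {n : ℕ}

/-- The identity rook `1 2 … n`. -/
def idRook (n : ℕ) : Rook n where
  letter i := i.val + 1
  le i := i.isLt
  inj i j h _ := Fin.ext (Nat.succ_injective h)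

/-- Right action of `π₀ = P₁`: replace the first letter by `0`. -/
def piZero (r : Rook n) : Rook n where
  letter i := if i.val = 0 then 0 else r.letter i
  le i := by
    split
    · exact Nat.zero_le n
    · exact r.le i
  inj i j h hi := by
    by_cases h0 : i.val = 0
    · simp [h0] at hi
    · by_cases h1 : j.val = 0
      · simp [h0, h1] at h hi
        exact absurd h hi
      · simp only [h0, h1, if_false] at h hi
        exact r.inj i j h hi

/-- Exchange the letters in the positions `k` and `k + 1` (counted from `0`). -/
def swapAt (k : ℕ) (hk : k + 1 < n) (r : Rook n) : Rook n where
  letter i := r.letter (Equiv.swap ⟨k, Nat.lt_of_succ_lt hk⟩ ⟨k + 1, hk⟩ i)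
  le i := r.le _
  inj i j h hi := (Equiv.swap _ _).injective (r.inj _ _ h hi)

/-- Right action of `π_{k+1}`, for `1 ≤ k + 1 ≤ n - 1`: exchange the letters in the coordinates
`k + 1` and `k + 2` (positions `k` and `k + 1` counted from `0`) if they are in strictly increasing
order, and do nothing otherwise. -/
def piSucc (k : ℕ) (hk : k + 1 < n) (r : Rook n) : Rook n :=
  if r.letter ⟨k, Nat.lt_of_succ_lt hk⟩ < r.letter ⟨k + 1, hk⟩ then swapAt k hk r else r

/-- The support: the set of nonzero letters. -/
def supp (r : Rook n) : Set ℕ := {l | l ≠ 0 ∧ ∃ i, r.letter i = l}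

/-- The set of inversions, as pairs (larger letter, smaller letter). -/
def Inv (r : Rook n) : Set (ℕ × ℕ) :=
  {p | ∃ i j, i < j ∧ r.letter j < r.letter i ∧ 0 < r.letter j ∧ p = (r.letter i, r.letter j)}

/-- For `l` in the support, the number of `0` after `l` in the rook vector; the value is `0` if `l`
is not in the support. -/
def zeros (r : Rook n) (l : ℕ) : ℕ :=
  (Finset.univ.filter fun j => l ≠ 0 ∧ r.letter j = 0 ∧ ∃ i, i < j ∧ r.letter i = l).card

end Rook

/-- Triples `(S, I, Z)`; the function `Z : S → ℕ` is extended by `0` outside `S`. -/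
@[ext]
structure Triple where
  S : Set ℕ
  I : Set (ℕ × ℕ)
  Z : ℕ → ℕ

/-- The rook triple associated to a rook. -/
def Rook.triple {n : ℕ} (r : Rook n) : Triple := ⟨r.supp, r.Inv, r.zeros⟩

/-- The `0`-rook monoid: the monoid of functions on rooks generated by `π₀ = P₁` and
`π₁, …, π_{n-1}`.  Functions act on the right, so that `x * y` is "first `x`, then `y`"; this is
the reason for the opposite monoid.  (For `n = 0` there is one rook only and `piZero` is the
identity.) -/
def zeroRookMonoid (n : ℕ) : Submonoid (Function.End (Rook n))ᵐᵒᵖ :=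
  Submonoid.closure
    ({MulOpposite.op (Rook.piZero : Rook n → Rook n)} ∪
      {f | ∃ (k : ℕ) (hk : k + 1 < n), f = MulOpposite.op (Rook.piSucc k hk)})

/-- The right action `r · x` of the `0`-rook monoid on rooks. -/
def Rook.act {n : ℕ} (r : Rook n) (x : zeroRookMonoid n) : Rook n := x.val.unop r

/-- Green's `R`-preorder on a monoid: inclusion of the principal right ideals. -/
def GreenRLE {M : Type*} [Monoid M] (x y : M) : Prop :=
  Set.range (fun m : M => x * m) ⊆ Set.range (fun m : M => y * m)

/-- `S` is `I`-compatible. -/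
def IsCompatible (I : Set (ℕ × ℕ)) (S : Set ℕ) : Prop :=
  ∀ b a, (b, a) ∈ I → b ∈ S → a ∈ S

/-- The transitive closure of a set of pairs. -/
def transClosure (I : Set (ℕ × ℕ)) : Set (ℕ × ℕ) :=
  {p | Relation.TransGen (fun b a => (b, a) ∈ I) p.1 p.2}

namespace Rook

variable {n : ℕ}

/-- `I₀`: the transitive closure of the union of the inversion sets. -/
def meetI₀ (u v : Rook n) : Set (ℕ × ℕ) := transClosure (u.Inv ∪ v.Inv)

/-- The `I₀`-compatible sets contained in the common support. -/
def meetCandidates (u v : Rook n) : Set (Set ℕ) :=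
  {T | T ⊆ u.supp ∩ v.supp ∧ IsCompatible (meetI₀ u v) T}

/-- The union of the `I₀`-compatible sets contained in the common support. -/
def meetS (u v : Rook n) : Set ℕ := ⋃₀ meetCandidates u v

/-- `I = I₀ ∩ S²`. -/
def meetI (u v : Rook n) : Set (ℕ × ℕ) := meetI₀ u v ∩ (meetS u v ×ˢ meetS u v)

/-- The set `{Z_u(i), Z_v(i) ∣ i = x or (x, i) ∈ I}`. -/
def meetZSet (u v : Rook n) (x : ℕ) : Set ℕ :=
  {z | ∃ i, (i = x ∨ (x, i) ∈ meetI u v) ∧ (z = u.zeros i ∨ z = v.zeros i)}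

open Classical in
/-- The triple `(S, I, Z)`, where `Z x` is the maximum of `meetZSet u v x` for `x ∈ S`. -/
noncomputable def meetTriple (u v : Rook n) : Triple where
  S := meetS u v
  I := meetI u v
  Z x := if x ∈ meetS u v then sSup (meetZSet u v x) else 0

end Rook

/-!
A rook is treated as a word on which the generators act as a sorting procedure: `piSucc` turns an
adjacent ascent into a descent and `piZero` deletes the first letter.  Three facts carry the proof.

*The order through triples.*  An abstract triple `T` lies below a rook `s` (`Rook.Below`) if its
letters are closed under the inversions of `s`, these are inversions of `T`, and `T` has at least as
many zeros after each of its letters.  If `T` satisfies the axioms `Rook.IsRookTriple` and is not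
the triple of `s`, then some generator moves `s` and keeps `T` below
(`Rook.Below.exists_generator`): the first letter of `s` outside `T` can be moved to the left and
deleted, and when there is none, any disagreement of inversions or zeros is visible at two adjacent
positions.  Since the potential `∑ (i + 1) rᵢ` drops with each move, the descent stops at a rook
with triple `T`.  For `T` the triple of a rook `r` this says that `r` is in the orbit of `s` exactly
if `r.triple` lies below `s` (`Rook.reach_iff_below`); in particular every rook is in the orbit of
the identity.  Antisymmetry holds because a rook is determined by its triple
(`Rook.triple_injective`).

*Meets.*  The meet triple of `u` and `v` satisfies the axioms (`Rook.isRookTriple_meetTriple`) and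
lies below `u` and `v`, so the same descent produces a rook with this triple in the orbits of both;
every common lower bound is below the meet triple because a chain of inversions of `u` and `v` that
starts in its support stays there.  Joins exist because the order is finite with a greatest element.

*Faithfulness.*  The element of the monoid is determined by the image of the identity rook.  The
transposed generators, which exchange letters instead of positions, commute with the right action,
and they produce every rook from the identity (`Rook.exists_left_preimage`); hence the action on any
rook is determined by the action on the identity (`Rook.act_eq_of_act_idRook`).  This makes
`x ↦ 1ₙ · x` a bijection that turns Green's `R`-preorder into the orbit order.
-/

namespace Rook

variable {n : ℕ}

/-! ### Positions, inversions and zeros -/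

theorem mem_Inv {s : Rook n} {b a : ℕ} :
    (b, a) ∈ s.Inv ↔ ∃ i j, i < j ∧ s.letter i = b ∧ s.letter j = a ∧ a < b ∧ 0 < a := by
  constructor
  · rintro ⟨i, j, hij, h1, h2, h3⟩
    simp only [Prod.mk.injEq] at h3
    obtain ⟨rfl, rfl⟩ := h3
    exact ⟨i, j, hij, rfl, rfl, h1, h2⟩
  · rintro ⟨i, j, hij, rfl, rfl, h1, h2⟩
    exact ⟨i, j, hij, h1, h2, rfl⟩

theorem letter_mem_Inv {s : Rook n} {i j : Fin n} (hi : s.letter i ≠ 0) (hj : s.letter j ≠ 0) :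
    (s.letter i, s.letter j) ∈ s.Inv ↔ i < j ∧ s.letter j < s.letter i := by
  rw [mem_Inv]
  constructor
  · rintro ⟨i', j', h, h1, h2, h3, -⟩
    obtain rfl := s.inj _ _ h1.symm hi
    obtain rfl := s.inj _ _ h2.symm hj
    exact ⟨h, h3⟩
  · rintro ⟨h, h'⟩
    exact ⟨i, j, h, rfl, rfl, h', Nat.pos_of_ne_zero hj⟩

theorem letter_mem_supp {s : Rook n} {i : Fin n} (hi : s.letter i ≠ 0) : s.letter i ∈ s.supp :=
  ⟨hi, i, rfl⟩

theorem Inv_subset {s : Rook n} {b a : ℕ} (h : (b, a) ∈ s.Inv) :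
    b ∈ s.supp ∧ a ∈ s.supp ∧ a < b := by
  obtain ⟨i, j, -, rfl, rfl, h1, h2⟩ := mem_Inv.1 h
  exact ⟨⟨by omega, i, rfl⟩, ⟨by omega, j, rfl⟩, h1⟩

theorem zeros_letter {s : Rook n} {i : Fin n} (hi : s.letter i ≠ 0) :
    s.zeros (s.letter i) = (Finset.univ.filter fun j => i < j ∧ s.letter j = 0).card := by
  unfold zeros
  congr 1
  ext j
  simp only [Finset.mem_filter, Finset.mem_univ, true_and]
  constructor
  · rintro ⟨-, h0, i', h1, h2⟩
    obtain rfl := s.inj _ _ h2.symm hi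
    exact ⟨h1, h0⟩
  · rintro ⟨h1, h0⟩
    exact ⟨hi, h0, i, h1, rfl⟩

theorem zeros_of_notMem {s : Rook n} {x : ℕ} (hx : x ∉ s.supp) : s.zeros x = 0 := by
  unfold zeros
  rw [Finset.card_eq_zero, Finset.filter_eq_empty_iff]
  rintro j - ⟨h0, -, i, -, h⟩
  exact hx ⟨h0, i, h⟩

theorem zeros_anti {s : Rook n} {i j : Fin n} (hi : s.letter i ≠ 0) (hj : s.letter j ≠ 0)
    (hij : i ≤ j) : s.zeros (s.letter j) ≤ s.zeros (s.letter i) := by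
  rw [zeros_letter hi, zeros_letter hj]
  apply Finset.card_le_card
  intro k
  simp only [Finset.mem_filter, Finset.mem_univ, true_and]
  exact fun h => ⟨lt_of_le_of_lt hij h.1, h.2⟩

theorem zeros_lt {s : Rook n} {i j k : Fin n} (hi : s.letter i ≠ 0) (hj : s.letter j ≠ 0)
    (hk : s.letter k = 0) (hik : i < k) (hkj : k < j) :
    s.zeros (s.letter j) < s.zeros (s.letter i) := by
  rw [zeros_letter hi, zeros_letter hj]
  apply Finset.card_lt_card
  rw [Finset.ssubset_iff_of_subset]
  · exact ⟨k, by simp [hik, hk], by simp [hkj.le]⟩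
  · intro l
    simp only [Finset.mem_filter, Finset.mem_univ, true_and]
    exact fun h => ⟨(hik.trans hkj).trans h.1, h.2⟩

theorem card_zero_add_ncard_supp (s : Rook n) :
    (Finset.univ.filter fun j => s.letter j = 0).card + s.supp.ncard = n := by
  have h : s.supp = s.letter '' {j | ¬ s.letter j = 0} := by
    ext l
    constructor
    · rintro ⟨h0, i, rfl⟩
      exact ⟨i, h0, rfl⟩
    · rintro ⟨i, h0, rfl⟩
      exact ⟨h0, i, rfl⟩
  have hinj : Set.InjOn s.letter {j | ¬ s.letter j = 0} := fun i hi j _ hij => s.inj i j hij hi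
  rw [h, hinj.ncard_image]
  have h2 : {j | ¬ s.letter j = 0} =
      ((Finset.univ.filter fun j => ¬ s.letter j = 0 : Finset (Fin n)) : Set (Fin n)) := by
    simp
  rw [h2, Set.ncard_coe_finset, Finset.card_filter_add_card_filter_not]
  simp

theorem finite_supp (s : Rook n) : s.supp.Finite := by
  apply (Set.finite_range s.letter).subset
  rintro l ⟨-, i, rfl⟩
  exact ⟨i, rfl⟩

theorem zeros_add_ncard_supp_le (s : Rook n) (x : ℕ) : s.zeros x + s.supp.ncard ≤ n := by
  have h := s.card_zero_add_ncard_supp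
  have : s.zeros x ≤ (Finset.univ.filter fun j => s.letter j = 0).card := by
    apply Finset.card_le_card
    intro k
    simp only [Finset.mem_filter, Finset.mem_univ, true_and]
    exact fun h => h.2.1
  omega

/-- A rook is determined by its triple: compare two rooks at the last position where they
differ. -/
theorem triple_injective : Function.Injective (triple : Rook n → Triple) := by
  intro s r h
  have hS : s.supp = r.supp := congrArg Triple.S h
  have hI : s.Inv = r.Inv := congrArg Triple.I h
  have hZ : s.zeros = r.zeros := congrArg Triple.Z h
  by_contra hne
  -- the last position where the words differ
  obtain ⟨j, hj, hmax⟩ : ∃ j, s.letter j ≠ r.letter j ∧ ∀ k, j < k → s.letter k = r.letter k := by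
    have hex : (Finset.univ.filter fun j => s.letter j ≠ r.letter j).Nonempty := by
      by_contra hemp
      rw [Finset.not_nonempty_iff_eq_empty, Finset.filter_eq_empty_iff] at hemp
      exact hne (Rook.ext (funext fun j => not_not.1 (hemp (Finset.mem_univ j))))
    refine ⟨_, (Finset.mem_filter.1 (Finset.max'_mem _ hex)).2, fun k hk => ?_⟩
    by_contra hk'
    exact absurd (Finset.le_max' _ k (by simpa using hk')) (not_le.2 hk)
  have before : ∀ s r : Rook n, s.supp = r.supp → (∀ k, j < k → s.letter k = r.letter k) →
      s.letter j ≠ r.letter j → s.letter j ≠ 0 → ∃ i, i < j ∧ r.letter i = s.letter j := by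
    intro s r hS hmax hj h0
    obtain ⟨-, i, hi⟩ := hS ▸ letter_mem_supp h0
    refine ⟨i, ?_, hi⟩
    rcases lt_trichotomy i j with h1 | rfl | h1
    · exact h1
    · exact absurd hi.symm hj
    · rw [← hmax i h1] at hi
      exact absurd (s.inj _ _ hi (hi ▸ h0)) h1.ne'
  have key : ∀ s r : Rook n, s.supp = r.supp → s.zeros = r.zeros →
      (∀ k, j < k → s.letter k = r.letter k) →
      s.letter j ≠ r.letter j → s.letter j ≠ 0 → r.letter j ≠ 0 := by
    intro s r hS hZ hmax hj h0 hr0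
    obtain ⟨i, hij, hi⟩ := before s r hS hmax hj h0
    have h1 := zeros_letter h0
    have h2 := zeros_letter (s := r) (i := i) (hi ▸ h0)
    rw [hi, ← hZ, h1] at h2
    refine absurd h2 (ne_of_lt ?_)
    apply Finset.card_lt_card
    rw [Finset.ssubset_iff_of_subset]
    · exact ⟨j, by simp [hij, hr0], by simp⟩
    · intro l
      simp only [Finset.mem_filter, Finset.mem_univ, true_and]
      exact fun h => ⟨hij.trans h.1, (hmax l h.1) ▸ h.2⟩
  have hs0 : s.letter j ≠ 0 := by
    intro h0
    exact key r s hS.symm hZ.symm (fun k hk => (hmax k hk).symm) hj.symm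
      (fun h => hj (h0.trans h.symm)) h0
  have hr0 := key s r hS hZ hmax hj hs0
  obtain ⟨i, hij, hi⟩ := before s r hS hmax hj hs0
  obtain ⟨i', hij', hi'⟩ := before r s hS.symm (fun k hk => (hmax k hk).symm) hj.symm hr0
  rcases lt_or_gt_of_ne hj with hlt | hlt
  · have h1 : (r.letter j, s.letter j) ∈ s.Inv := by
      rw [← hi', letter_mem_Inv (hi' ▸ hr0) hs0, hi']
      exact ⟨hij', hlt⟩
    rw [hI, ← hi, letter_mem_Inv hr0 (hi ▸ hs0)] at h1
    exact absurd h1.1 hij.not_gt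
  · have h1 : (s.letter j, r.letter j) ∈ r.Inv := by
      rw [← hi, letter_mem_Inv (hi ▸ hs0) hr0, hi]
      exact ⟨hij, hlt⟩
    rw [← hI, ← hi', letter_mem_Inv hs0 (hi' ▸ hr0)] at h1
    exact absurd h1.1 hij'.not_gt

/-! ### Rook triples and the comparison of rooks with triples -/

/-- The axioms of a rook triple of size `n`: a set of letters, a transitive and cotransitive set of
inversions on it, and a number of zeros for each letter that is at most the number `n - |S|` of
zeros available and does not increase from a letter to a later one. -/
structure IsRookTriple (n : ℕ) (T : Triple) : Prop where
  mem : ∀ b a, (b, a) ∈ T.I → b ∈ T.S ∧ a ∈ T.S ∧ a < b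
  trans : ∀ c b a, (c, b) ∈ T.I → (b, a) ∈ T.I → (c, a) ∈ T.I
  cotrans : ∀ c b a, (c, a) ∈ T.I → b ∈ T.S → a < b → b < c → (c, b) ∈ T.I ∨ (b, a) ∈ T.I
  zeros_le : ∀ x ∈ T.S, T.Z x + T.S.ncard ≤ n
  zeros_off : ∀ x, x ∉ T.S → T.Z x = 0
  zeros_inv : ∀ b a, (b, a) ∈ T.I → T.Z a ≤ T.Z b
  zeros_noninv : ∀ b a, b ∈ T.S → a ∈ T.S → a < b → (b, a) ∉ T.I → T.Z b ≤ T.Z a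

/-- For letters `a < b` of the support that do not form an inversion, `a` comes before `b`. -/
theorem lt_of_notMem_Inv {s : Rook n} {i j : Fin n} (hi : s.letter i ≠ 0)
    (hij : s.letter i < s.letter j) (h : (s.letter j, s.letter i) ∉ s.Inv) : i < j := by
  rw [letter_mem_Inv (by omega) hi] at h
  rcases lt_trichotomy i j with h1 | rfl | h1
  · exact h1
  · exact absurd hij (lt_irrefl _)
  · exact absurd ⟨h1, hij⟩ h

theorem Inv_trans {s : Rook n} {c b a : ℕ} (h1 : (c, b) ∈ s.Inv) (h2 : (b, a) ∈ s.Inv) :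
    (c, a) ∈ s.Inv := by
  obtain ⟨i, j, hij, rfl, rfl, h, h'⟩ := mem_Inv.1 h1
  obtain ⟨j', k, hjk, e, rfl, h3, h4⟩ := mem_Inv.1 h2
  obtain rfl := s.inj _ _ e (by omega)
  exact mem_Inv.2 ⟨i, k, hij.trans hjk, rfl, rfl, by omega, h4⟩

theorem Inv_cotrans {s : Rook n} {c b a : ℕ} (h : (c, a) ∈ s.Inv) (hb : b ∈ s.supp)
    (hab : a < b) (hbc : b < c) : (c, b) ∈ s.Inv ∨ (b, a) ∈ s.Inv := by
  obtain ⟨i, j, hij, rfl, rfl, h1, h2⟩ := mem_Inv.1 h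
  obtain ⟨hb0, k, rfl⟩ := hb
  rw [letter_mem_Inv (by omega) hb0, letter_mem_Inv hb0 (by omega)]
  rcases lt_or_ge i k with hik | hik
  · exact Or.inl ⟨hik, hbc⟩
  · exact Or.inr ⟨lt_of_le_of_lt hik hij, hab⟩

theorem zeros_le_of_mem_Inv {s : Rook n} {b a : ℕ} (h : (b, a) ∈ s.Inv) :
    s.zeros a ≤ s.zeros b := by
  obtain ⟨i, j, hij, rfl, rfl, h1, h2⟩ := mem_Inv.1 h
  exact zeros_anti (by omega) (by omega) hij.le

theorem zeros_le_of_notMem_Inv {s : Rook n} {b a : ℕ} (hb : b ∈ s.supp) (ha : a ∈ s.supp)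
    (hab : a < b) (h : (b, a) ∉ s.Inv) : s.zeros b ≤ s.zeros a := by
  obtain ⟨hb0, j, rfl⟩ := hb
  obtain ⟨ha0, i, rfl⟩ := ha
  exact zeros_anti ha0 hb0 (lt_of_notMem_Inv ha0 hab h).le

theorem isRookTriple_triple (s : Rook n) : IsRookTriple n s.triple where
  mem _ _ h := Inv_subset h
  trans _ _ _ := Inv_trans
  cotrans _ _ _ := Inv_cotrans
  zeros_le x _ := s.zeros_add_ncard_supp_le x
  zeros_off _ := zeros_of_notMem
  zeros_inv _ _ := zeros_le_of_mem_Inv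
  zeros_noninv _ _ := zeros_le_of_notMem_Inv

/-- `Below T s`: the triple `T` lies below the rook `s`.  Its letters are letters of `s`, they are
closed under the inversions of `s`, which are inversions of `T`, and in `T` each of them has at
least as many zeros after it as in `s`.  For the triple of a rook this turns out to be the
`R`-order. -/
structure Below (T : Triple) (s : Rook n) : Prop where
  subset : T.S ⊆ s.supp
  inv : ∀ b a, (b, a) ∈ s.Inv → b ∈ T.S → a ∈ T.S ∧ (b, a) ∈ T.I
  zeros_le : ∀ x ∈ T.S, s.zeros x ≤ T.Z x

theorem Below.refl (s : Rook n) : Below s.triple s :=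
  ⟨subset_rfl, fun _ _ h _ => ⟨(Inv_subset h).2.1, h⟩, fun _ _ => le_rfl⟩

theorem Below.trans {T : Triple} {r s : Rook n} (h : Below T r) (h' : Below r.triple s) :
    Below T s where
  subset := h.subset.trans h'.subset
  inv b a hba hb := h.inv b a (h'.inv b a hba (h.subset hb)).2 hb
  zeros_le x hx := (h'.zeros_le x (h.subset hx)).trans (h.zeros_le x hx)

/-! ### The effect of a generator on the triple -/

/-- The transposition of the adjacent positions `k` and `k + 1`. -/
def adj (k : ℕ) (hk : k + 1 < n) : Equiv.Perm (Fin n) :=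
  Equiv.swap ⟨k, Nat.lt_of_succ_lt hk⟩ ⟨k + 1, hk⟩

theorem adj_lt_adj (k : ℕ) (hk : k + 1 < n) (i j : Fin n) :
    adj k hk i < adj k hk j ↔
      (i < j ∧ ¬ (i.val = k ∧ j.val = k + 1)) ∨ (i.val = k + 1 ∧ j.val = k) := by
  simp only [adj, Equiv.swap_apply_def, Fin.ext_iff]
  split_ifs <;> simp only [Fin.lt_def] <;> omega

theorem swapAt_letter_adj (k : ℕ) (hk : k + 1 < n) (s : Rook n) (i : Fin n) :
    (swapAt k hk s).letter (adj k hk i) = s.letter i := by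
  simp [swapAt, adj]

theorem adj_left (k : ℕ) (hk : k + 1 < n) :
    adj k hk ⟨k, Nat.lt_of_succ_lt hk⟩ = ⟨k + 1, hk⟩ := by simp [adj]

theorem adj_right (k : ℕ) (hk : k + 1 < n) :
    adj k hk ⟨k + 1, hk⟩ = ⟨k, Nat.lt_of_succ_lt hk⟩ := by simp [adj]

theorem supp_swapAt (k : ℕ) (hk : k + 1 < n) (s : Rook n) : (swapAt k hk s).supp = s.supp := by
  ext l
  simp only [supp, Set.mem_ofPred_eq, and_congr_right_iff]
  intro _
  rw [(adj k hk).surjective.exists]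
  simp only [swapAt_letter_adj]

theorem mem_Inv_swapAt {k : ℕ} {hk : k + 1 < n} {s : Rook n}
    (h : s.letter ⟨k, Nat.lt_of_succ_lt hk⟩ < s.letter ⟨k + 1, hk⟩) {b a : ℕ} :
    (b, a) ∈ (swapAt k hk s).Inv ↔ (b, a) ∈ s.Inv ∨
      (b = s.letter ⟨k + 1, hk⟩ ∧ a = s.letter ⟨k, Nat.lt_of_succ_lt hk⟩ ∧ a ≠ 0) := by
  rw [mem_Inv, (adj k hk).surjective.exists₂]
  simp only [swapAt_letter_adj, adj_lt_adj]
  rw [mem_Inv]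
  constructor
  · rintro ⟨i, j, (⟨hij, -⟩ | ⟨hi, hj⟩), rfl, rfl, h1, h2⟩
    · exact Or.inl ⟨i, j, hij, rfl, rfl, h1, h2⟩
    · obtain rfl : i = ⟨k + 1, hk⟩ := Fin.ext hi
      obtain rfl : j = ⟨k, Nat.lt_of_succ_lt hk⟩ := Fin.ext hj
      exact Or.inr ⟨rfl, rfl, h2.ne'⟩
  · rintro (⟨i, j, hij, rfl, rfl, h1, h2⟩ | ⟨rfl, rfl, h0⟩)
    · refine ⟨i, j, Or.inl ⟨hij, ?_⟩, rfl, rfl, h1, h2⟩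
      rintro ⟨hi, hj⟩
      obtain rfl : i = ⟨k, Nat.lt_of_succ_lt hk⟩ := Fin.ext hi
      obtain rfl : j = ⟨k + 1, hk⟩ := Fin.ext hj
      omega
    · exact ⟨_, _, Or.inr ⟨rfl, rfl⟩, rfl, rfl, h, Nat.pos_of_ne_zero h0⟩

theorem zeros_swapAt_letter {k : ℕ} {hk : k + 1 < n} {s : Rook n} {i : Fin n}
    (h : s.letter ⟨k, Nat.lt_of_succ_lt hk⟩ < s.letter ⟨k + 1, hk⟩) (hi : s.letter i ≠ 0) :
    (swapAt k hk s).zeros (s.letter i) = s.zeros (s.letter i) +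
      if i.val = k + 1 ∧ s.letter ⟨k, Nat.lt_of_succ_lt hk⟩ = 0 then 1 else 0 := by
  have e := zeros_letter (s := swapAt k hk s) (i := adj k hk i) (by rwa [swapAt_letter_adj])
  rw [swapAt_letter_adj] at e
  rw [e, zeros_letter hi]
  have e2 : (Finset.univ.filter fun j => adj k hk i < j ∧ (swapAt k hk s).letter j = 0) =
      (Finset.univ.filter fun j => adj k hk i < adj k hk j ∧ s.letter j = 0).map
        (adj k hk).toEmbedding := by
    ext j
    obtain ⟨j, rfl⟩ := (adj k hk).surjective j
    simp [swapAt_letter_adj]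
  rw [e2, Finset.card_map]
  simp only [adj_lt_adj]
  split_ifs with hc
  · obtain ⟨hik, h0⟩ := hc
    have hnot : (⟨k, Nat.lt_of_succ_lt hk⟩ : Fin n) ∉
        Finset.univ.filter fun j => i < j ∧ s.letter j = 0 := by
      simp [Fin.lt_def, hik]
    rw [← Finset.card_insert_of_notMem hnot]
    congr 1
    ext j
    simp only [Finset.mem_filter, Finset.mem_univ, true_and, Finset.mem_insert, Fin.ext_iff]
    constructor
    · rintro ⟨h1 | h1, h2⟩
      · exact Or.inr ⟨h1.1, h2⟩
      · exact Or.inl h1.2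
    · rintro (h1 | h1)
      · obtain rfl : j = ⟨k, Nat.lt_of_succ_lt hk⟩ := Fin.ext h1
        exact ⟨Or.inr ⟨hik, rfl⟩, h0⟩
      · exact ⟨Or.inl ⟨h1.1, by omega⟩, h1.2⟩
  · rw [add_zero]
    congr 1
    ext j
    simp only [Finset.mem_filter, Finset.mem_univ, true_and]
    constructor
    · rintro ⟨h1 | h1, h2⟩
      · exact ⟨h1.1, h2⟩
      · obtain rfl : j = ⟨k, Nat.lt_of_succ_lt hk⟩ := Fin.ext h1.2
        exact absurd ⟨h1.1, h2⟩ hc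
    · rintro ⟨h1, h2⟩
      refine ⟨Or.inl ⟨h1, ?_⟩, h2⟩
      rintro ⟨-, hj⟩
      obtain rfl : j = ⟨k + 1, hk⟩ := Fin.ext hj
      omega

/-- Exchanging the adjacent letters `a < b` keeps `T` below as long as the pair is an inversion of
`T`, or `b` is not in `T`, or `a = 0` and `b` has fewer zeros after it than in `T`. -/
theorem Below.swapAt {T : Triple} {s : Rook n} (hT : Below T s) {k : ℕ} {hk : k + 1 < n}
    (h : s.letter ⟨k, Nat.lt_of_succ_lt hk⟩ < s.letter ⟨k + 1, hk⟩)
    (hinv : s.letter ⟨k + 1, hk⟩ ∈ T.S → s.letter ⟨k, Nat.lt_of_succ_lt hk⟩ ≠ 0 →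
      s.letter ⟨k, Nat.lt_of_succ_lt hk⟩ ∈ T.S ∧
        (s.letter ⟨k + 1, hk⟩, s.letter ⟨k, Nat.lt_of_succ_lt hk⟩) ∈ T.I)
    (hzero : s.letter ⟨k + 1, hk⟩ ∈ T.S → s.letter ⟨k, Nat.lt_of_succ_lt hk⟩ = 0 →
      s.zeros (s.letter ⟨k + 1, hk⟩) < T.Z (s.letter ⟨k + 1, hk⟩)) :
    Below T (swapAt k hk s) where
  subset := by rw [supp_swapAt]; exact hT.subset
  inv b a hba hb := by
    rw [mem_Inv_swapAt h] at hba
    rcases hba with hba | ⟨rfl, rfl, h0⟩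
    · exact hT.inv b a hba hb
    · exact hinv hb h0
  zeros_le x hx := by
    obtain ⟨h0, i, rfl⟩ := hT.subset hx
    rw [zeros_swapAt_letter h h0]
    split_ifs with hc
    · obtain rfl : i = ⟨k + 1, hk⟩ := Fin.ext hc.1
      exact hzero hx hc.2
    · exact hT.zeros_le _ hx

theorem below_swapAt {s : Rook n} {k : ℕ} {hk : k + 1 < n}
    (h : s.letter ⟨k, Nat.lt_of_succ_lt hk⟩ < s.letter ⟨k + 1, hk⟩) :
    Below (Rook.swapAt k hk s).triple s where
  subset := (supp_swapAt k hk s).le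
  inv b a hba _ := ⟨by
    change a ∈ (Rook.swapAt k hk s).supp
    rw [supp_swapAt]
    exact (Inv_subset hba).2.1, (mem_Inv_swapAt h).2 (Or.inl hba)⟩
  zeros_le x hx := by
    have hx' : x ∈ s.supp := (supp_swapAt k hk s).le hx
    obtain ⟨h0, i, rfl⟩ := hx'
    change _ ≤ (Rook.swapAt k hk s).zeros _
    rw [zeros_swapAt_letter h h0]
    exact Nat.le_add_right _ _

theorem piZero_letter_of_pos {s : Rook n} {i : Fin n} (hi : i.val ≠ 0) :
    s.piZero.letter i = s.letter i := by
  simp [piZero, hi]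

theorem piZero_letter_zero {s : Rook n} {i : Fin n} (hi : i.val = 0) :
    s.piZero.letter i = 0 := by
  simp [piZero, hi]

theorem mem_supp_piZero {s : Rook n} {x : ℕ} :
    x ∈ s.piZero.supp ↔ x ≠ 0 ∧ ∃ i, i.val ≠ 0 ∧ s.letter i = x := by
  constructor
  · rintro ⟨h0, i, rfl⟩
    have hi : i.val ≠ 0 := fun hi => h0 (piZero_letter_zero hi)
    exact ⟨h0, i, hi, (piZero_letter_of_pos hi).symm⟩
  · rintro ⟨h0, i, hi, rfl⟩
    exact ⟨h0, i, piZero_letter_of_pos hi⟩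

theorem supp_piZero_subset (s : Rook n) : s.piZero.supp ⊆ s.supp := by
  intro x hx
  obtain ⟨h0, i, -, h⟩ := mem_supp_piZero.1 hx
  exact ⟨h0, i, h⟩

theorem mem_Inv_piZero {s : Rook n} {b a : ℕ} :
    (b, a) ∈ s.piZero.Inv ↔ (b, a) ∈ s.Inv ∧ b ∈ s.piZero.supp := by
  constructor
  · intro h
    refine ⟨?_, (Inv_subset h).1⟩
    obtain ⟨i, j, hij, rfl, rfl, h1, h2⟩ := mem_Inv.1 h
    have hi : i.val ≠ 0 := fun hi => by simp [piZero_letter_zero hi] at h1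
    have hj : j.val ≠ 0 := fun hj => by simp [piZero_letter_zero hj] at h2
    rw [piZero_letter_of_pos hi, piZero_letter_of_pos hj] at *
    exact mem_Inv.2 ⟨i, j, hij, rfl, rfl, h1, h2⟩
  · rintro ⟨h, hb⟩
    obtain ⟨i, j, hij, rfl, rfl, h1, h2⟩ := mem_Inv.1 h
    obtain ⟨h0, i', hi', e⟩ := mem_supp_piZero.1 hb
    obtain rfl := s.inj _ _ e.symm h0
    have hj : j.val ≠ 0 := by rw [Fin.lt_def] at hij; omega
    exact mem_Inv.2 ⟨i, j, hij, piZero_letter_of_pos hi', piZero_letter_of_pos hj, h1, h2⟩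

theorem zeros_piZero {s : Rook n} {x : ℕ} (hx : x ∈ s.piZero.supp) :
    s.piZero.zeros x = s.zeros x := by
  obtain ⟨h0, i, hi, rfl⟩ := mem_supp_piZero.1 hx
  have e := zeros_letter (s := s.piZero) (i := i) (by rwa [piZero_letter_of_pos hi])
  rw [piZero_letter_of_pos hi] at e
  rw [e, zeros_letter h0]
  congr 1
  ext j
  simp only [Finset.mem_filter, Finset.mem_univ, true_and, and_congr_right_iff]
  intro hj
  rw [piZero_letter_of_pos (by rw [Fin.lt_def] at hj; omega)]

theorem below_piZero (s : Rook n) : Below s.piZero.triple s where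
  subset := s.supp_piZero_subset
  inv b a hba hb := by
    have h := mem_Inv_piZero.2 ⟨hba, hb⟩
    exact ⟨(Inv_subset h).2.1, h⟩
  zeros_le x hx := (zeros_piZero hx).ge

/-- Deleting a first letter that is not in `T` keeps `T` below. -/
theorem Below.piZero {T : Triple} {s : Rook n} (hT : Below T s)
    (h : ∀ i : Fin n, i.val = 0 → s.letter i ∉ T.S) : Below T s.piZero := by
  have hsub : T.S ⊆ s.piZero.supp := by
    intro x hx
    obtain ⟨h0, i, rfl⟩ := hT.subset hx
    exact mem_supp_piZero.2 ⟨h0, i, fun hi => h i hi hx, rfl⟩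
  refine ⟨hsub, fun b a hba hb => hT.inv b a (mem_Inv_piZero.1 hba).1 hb, fun x hx => ?_⟩
  rw [zeros_piZero (hsub hx)]
  exact hT.zeros_le x hx

/-! ### The descent to a triple -/

/-- The descent step: if a rook triple `T` lies below `s` and is not the triple of `s`, some
generator moves `s` and keeps `T` below. -/
theorem Below.exists_generator {T : Triple} {s : Rook n} (hT : IsRookTriple n T) (h : Below T s)
    (hne : s.triple ≠ T) :
    (s.piZero ≠ s ∧ Below T s.piZero) ∨
      ∃ (k : ℕ) (hk : k + 1 < n), s.letter ⟨k, Nat.lt_of_succ_lt hk⟩ < s.letter ⟨k + 1, hk⟩ ∧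
        Below T (Rook.swapAt k hk s) := by
  by_contra hcon
  rw [not_or] at hcon
  obtain ⟨hA, hB⟩ := hcon
  push Not at hA hB
  -- all letters of `s` are in `T`: look at what precedes the first one that is not
  have hlive : ∀ m, ∀ hm : m < n, s.letter ⟨m, hm⟩ ≠ 0 → s.letter ⟨m, hm⟩ ∈ T.S := by
    intro m
    induction m with
    | zero =>
      intro hm h0
      by_contra hdead
      refine hA (fun e => h0 ?_) (h.piZero fun i hi => ?_)
      · rw [← e]
        exact piZero_letter_zero rfl
      · obtain rfl : i = ⟨0, hm⟩ := Fin.ext hi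
        exact hdead
    | succ k ih =>
      intro hk h0
      by_contra hdead
      by_cases hlt : s.letter ⟨k, Nat.lt_of_succ_lt hk⟩ < s.letter ⟨k + 1, hk⟩
      · exact hB k hk hlt (h.swapAt hlt (fun hb => absurd hb hdead) (fun hb => absurd hb hdead))
      · have hk0 : s.letter ⟨k, Nat.lt_of_succ_lt hk⟩ ≠ 0 := by omega
        have hneq : s.letter ⟨k, Nat.lt_of_succ_lt hk⟩ ≠ s.letter ⟨k + 1, hk⟩ := fun e => by
          have := congrArg Fin.val (s.inj _ _ e hk0)
          simp at this
        refine hdead (h.inv _ _ ((letter_mem_Inv hk0 h0).2 ⟨?_, ?_⟩) (ih _ hk0)).1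
        · simp [Fin.lt_def]
        · omega
  have hS : s.supp = T.S := by
    refine subset_antisymm ?_ h.subset
    rintro x ⟨h0, i, rfl⟩
    exact hlive i.val i.isLt h0
  have hpair : ∀ k (hk : k + 1 < n), s.letter ⟨k, Nat.lt_of_succ_lt hk⟩ ≠ 0 →
      s.letter ⟨k, Nat.lt_of_succ_lt hk⟩ < s.letter ⟨k + 1, hk⟩ →
      (s.letter ⟨k + 1, hk⟩, s.letter ⟨k, Nat.lt_of_succ_lt hk⟩) ∉ T.I := by
    intro k hk h0 hlt hI
    exact hB k hk hlt (h.swapAt hlt (fun _ _ => ⟨hlive _ _ h0, hI⟩) fun _ h0' => absurd h0' h0)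
  -- the numbers of zeros agree, by induction from the left
  have hZ : ∀ m, ∀ hm : m < n, s.letter ⟨m, hm⟩ ≠ 0 →
      T.Z (s.letter ⟨m, hm⟩) ≤ s.zeros (s.letter ⟨m, hm⟩) := by
    intro m
    induction m with
    | zero =>
      intro hm h0
      have h1 := hT.zeros_le _ (hlive _ hm h0)
      have h2 := s.card_zero_add_ncard_supp
      rw [hS] at h2
      have h3 : (Finset.univ.filter fun j => s.letter j = 0) =
          Finset.univ.filter fun j => (⟨0, hm⟩ : Fin n) < j ∧ s.letter j = 0 := by
        ext j
        simp only [Finset.mem_filter, Finset.mem_univ, true_and, iff_and_self]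
        intro hj
        rw [Fin.lt_def]
        refine Nat.pos_of_ne_zero fun hj0 => h0 ?_
        obtain rfl : j = ⟨0, hm⟩ := Fin.ext hj0
        exact hj
      rw [zeros_letter h0, ← h3]
      omega
    | succ k ih =>
      intro hk h0
      by_cases hk0 : s.letter ⟨k, Nat.lt_of_succ_lt hk⟩ = 0
      · by_contra hlt
        refine hB k hk (by omega) (h.swapAt (by omega) (fun _ h' => absurd hk0 h') fun _ _ => ?_)
        omega
      · have hlt : (⟨k, Nat.lt_of_succ_lt hk⟩ : Fin n) < ⟨k + 1, hk⟩ := by simp [Fin.lt_def]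
        have hstep : T.Z (s.letter ⟨k + 1, hk⟩) ≤ T.Z (s.letter ⟨k, Nat.lt_of_succ_lt hk⟩) := by
          rcases lt_trichotomy (s.letter ⟨k, Nat.lt_of_succ_lt hk⟩) (s.letter ⟨k + 1, hk⟩)
            with hc | hc | hc
          · exact hT.zeros_noninv _ _ (hlive _ _ h0) (hlive _ _ hk0) hc (hpair k hk hk0 hc)
          · rw [hc]
          · exact hT.zeros_inv _ _
              (h.inv _ _ ((letter_mem_Inv hk0 h0).2 ⟨hlt, hc⟩) (hlive _ _ hk0)).2
        have heq : s.zeros (s.letter ⟨k, Nat.lt_of_succ_lt hk⟩) =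
            s.zeros (s.letter ⟨k + 1, hk⟩) := by
          rw [zeros_letter hk0, zeros_letter h0]
          congr 1
          ext j
          simp only [Finset.mem_filter, Finset.mem_univ, true_and, and_congr_left_iff, Fin.lt_def]
          intro hj
          have : j.val ≠ k + 1 := by
            intro hjk
            obtain rfl : j = ⟨k + 1, hk⟩ := Fin.ext hjk
            exact h0 hj
          omega
        have := ih (Nat.lt_of_succ_lt hk) hk0
        omega
  have hZeq : ∀ x ∈ T.S, s.zeros x = T.Z x := by
    intro x hx
    refine le_antisymm (h.zeros_le x hx) ?_
    obtain ⟨h0, i, rfl⟩ := hS.ge hx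
    exact hZ i.val i.isLt h0
  -- a pair of letters that is in order in `s` is not an inversion of `T`, by induction on the
  -- distance of the two letters
  have hI : ∀ d, ∀ i j : Fin n, j.val = i.val + (d + 1) → s.letter i ≠ 0 →
      s.letter i < s.letter j → (s.letter j, s.letter i) ∉ T.I := by
    intro d
    induction d with
    | zero =>
      intro i j hij h0 hlt
      have hk : i.val + 1 < n := by have := j.isLt; omega
      obtain rfl : j = ⟨i.val + 1, hk⟩ := Fin.ext hij
      exact hpair i.val hk h0 hlt
    | succ d ih =>
      intro i j hij h0 hlt hmem
      have hjn := j.isLt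
      obtain ⟨c, hc⟩ : ∃ c : Fin n, c.val = i.val + 1 := ⟨⟨i.val + 1, by omega⟩, rfl⟩
      have hic : i < c := by rw [Fin.lt_def]; omega
      have hcj : c < j := by rw [Fin.lt_def]; omega
      have hj0 : s.letter j ≠ 0 := by omega
      have hiS : s.letter i ∈ T.S := hlive _ i.isLt h0
      have hjS : s.letter j ∈ T.S := hlive _ j.isLt hj0
      by_cases hc0 : s.letter c = 0
      · have h1 := zeros_lt h0 hj0 hc0 hic hcj
        have h2 := hT.zeros_inv _ _ hmem
        rw [hZeq _ hiS, hZeq _ hjS] at h1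
        omega
      · have hcS := hlive _ c.isLt hc0
        have hne_i : s.letter c ≠ s.letter i := fun e => hic.ne' (s.inj _ _ e hc0)
        have hne_j : s.letter c ≠ s.letter j := fun e => hcj.ne (s.inj _ _ e hc0)
        have hshort : s.letter c < s.letter j → (s.letter j, s.letter c) ∉ T.I :=
          ih c j (by omega) hc0
        have hadj : s.letter i < s.letter c → (s.letter c, s.letter i) ∉ T.I := by
          have hk : i.val + 1 < n := by omega
          obtain rfl : c = ⟨i.val + 1, hk⟩ := Fin.ext hc
          exact hpair i.val hk h0
        rcases lt_or_gt_of_ne hne_i with hci | hci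
        · have h1 := (h.inv _ _ ((letter_mem_Inv h0 hc0).2 ⟨hic, hci⟩) hiS).2
          exact hshort (by omega) (hT.trans _ _ _ hmem h1)
        · rcases lt_or_gt_of_ne hne_j with hcj' | hcj'
          · rcases hT.cotrans _ _ _ hmem hcS hci hcj' with h1 | h1
            · exact hshort hcj' h1
            · exact hadj hci h1
          · have h1 := (h.inv _ _ ((letter_mem_Inv hc0 hj0).2 ⟨hcj, hcj'⟩) hcS).2
            exact hadj hci (hT.trans _ _ _ h1 hmem)
  refine hne (Triple.ext hS ?_ ?_)
  · ext ⟨b, a⟩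
    constructor
    · exact fun hba => (h.inv b a hba (hS.le (Inv_subset hba).1)).2
    · intro hba
      obtain ⟨hb, ha, hab⟩ := hT.mem b a hba
      obtain ⟨hb0, j, rfl⟩ := hS.ge hb
      obtain ⟨ha0, i, rfl⟩ := hS.ge ha
      by_contra hnot
      have hij := lt_of_notMem_Inv ha0 hab hnot
      rw [Fin.lt_def] at hij
      exact hI (j.val - i.val - 1) i j (by omega) ha0 hab hba
  · funext x
    by_cases hx : x ∈ T.S
    · exact hZeq x hx
    · rw [hT.zeros_off x hx]
      exact zeros_of_notMem (fun hx' => hx (hS.le hx'))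

/-- The potential `∑ (i + 1) rᵢ`: it drops whenever a generator moves a rook. -/
def weight (s : Rook n) : ℕ := ∑ i : Fin n, (i.val + 1) * s.letter i

theorem weight_lt_of_exchange {s r : Rook n} {i j : Fin n} (hij : i < j)
    (hlt : s.letter i < s.letter j) (hi : r.letter i = s.letter j) (hj : r.letter j = s.letter i)
    (h : ∀ k, k ≠ i → k ≠ j → r.letter k = s.letter k) : r.weight < s.weight := by
  unfold weight
  have hmem : j ∈ Finset.univ.erase i := by simp [hij.ne']
  rw [← Finset.add_sum_erase _ _ (Finset.mem_univ i), ← Finset.add_sum_erase _ _ hmem,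
    ← Finset.add_sum_erase (a := i) _ (fun k => (k.val + 1) * s.letter k) (Finset.mem_univ i),
    ← Finset.add_sum_erase _ (fun k => (k.val + 1) * s.letter k) hmem]
  have hrest : ∑ k ∈ (Finset.univ.erase i).erase j, (k.val + 1) * r.letter k =
      ∑ k ∈ (Finset.univ.erase i).erase j, (k.val + 1) * s.letter k := by
    refine Finset.sum_congr rfl fun k hk => ?_
    simp only [Finset.mem_erase, Finset.mem_univ, and_true] at hk
    rw [h k hk.2 hk.1]
  rw [hrest, hi, hj]
  rw [Fin.lt_def] at hij
  have : (i.val + 1) * s.letter j + (j.val + 1) * s.letter i <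
      (i.val + 1) * s.letter i + (j.val + 1) * s.letter j := by
    obtain ⟨d, hd⟩ := Nat.exists_eq_add_of_lt hij
    obtain ⟨e, he⟩ := Nat.exists_eq_add_of_lt hlt
    rw [hd, he]
    nlinarith [Nat.zero_le (d * e)]
  omega

theorem weight_lt_of_le {s r : Rook n} (hle : ∀ i, r.letter i ≤ s.letter i) (hne : r ≠ s) :
    r.weight < s.weight := by
  obtain ⟨i, hi⟩ : ∃ i, r.letter i ≠ s.letter i := by
    by_contra! hall
    exact hne (Rook.ext (funext hall))
  refine Finset.sum_lt_sum (fun k _ => Nat.mul_le_mul_left _ (hle k)) ⟨i, Finset.mem_univ i, ?_⟩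
  exact Nat.mul_lt_mul_of_pos_left (lt_of_le_of_ne (hle i) hi) (Nat.succ_pos _)

theorem weight_swapAt_lt {s : Rook n} {k : ℕ} {hk : k + 1 < n}
    (h : s.letter ⟨k, Nat.lt_of_succ_lt hk⟩ < s.letter ⟨k + 1, hk⟩) :
    (swapAt k hk s).weight < s.weight := by
  refine weight_lt_of_exchange (i := ⟨k, Nat.lt_of_succ_lt hk⟩) (j := ⟨k + 1, hk⟩)
    (by simp [Fin.lt_def]) h (by simp [swapAt]) (by simp [swapAt]) fun l h1 h2 => ?_
  simp [swapAt, Equiv.swap_apply_of_ne_of_ne h1 h2]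

theorem weight_piZero_lt {s : Rook n} (h : s.piZero ≠ s) : s.piZero.weight < s.weight := by
  refine weight_lt_of_le (fun i => ?_) h
  by_cases hi : i.val = 0
  · simp [piZero_letter_zero hi]
  · exact (piZero_letter_of_pos hi).le

theorem weight_le (s : Rook n) : s.weight ≤ n * (n * n) := by
  calc s.weight ≤ ∑ _i : Fin n, n * n :=
        Finset.sum_le_sum fun i _ => Nat.mul_le_mul i.isLt (s.le i)
    _ = n * (n * n) := by simp

/-! ### Orbits of the monoid -/

/-- `r` is in the orbit `s · Rₙ⁰`. -/
def Reach (s r : Rook n) : Prop := ∃ m : zeroRookMonoid n, s.act m = r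

theorem act_one (s : Rook n) : s.act 1 = s := rfl

theorem act_mul (s : Rook n) (x y : zeroRookMonoid n) : s.act (x * y) = (s.act x).act y := rfl

theorem Reach.trans {s r t : Rook n} (h : Reach s r) (h' : Reach r t) : Reach s t := by
  obtain ⟨x, rfl⟩ := h
  obtain ⟨y, rfl⟩ := h'
  exact ⟨x * y, act_mul s x y⟩

theorem reach_piZero (s : Rook n) : Reach s s.piZero :=
  ⟨⟨_, Submonoid.subset_closure (Or.inl rfl)⟩, rfl⟩

theorem reach_piSucc (k : ℕ) (hk : k + 1 < n) (s : Rook n) : Reach s (piSucc k hk s) :=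
  ⟨⟨_, Submonoid.subset_closure (Or.inr ⟨k, hk, rfl⟩)⟩, rfl⟩

/-- Every rook triple below `s` is the triple of a rook in the orbit of `s`. -/
theorem Below.exists_reach {T : Triple} {s : Rook n} (hT : IsRookTriple n T) (h : Below T s) :
    ∃ r, Reach s r ∧ r.triple = T := by
  induction hw : s.weight using Nat.strong_induction_on generalizing s with
  | _ w ih =>
    subst hw
    by_cases hne : s.triple = T
    · exact ⟨s, ⟨1, act_one s⟩, hne⟩
    · rcases h.exists_generator hT hne with ⟨h1, h2⟩ | ⟨k, hk, hlt, h2⟩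
      · obtain ⟨r, hr, e⟩ := ih _ (weight_piZero_lt h1) h2 rfl
        exact ⟨r, s.reach_piZero.trans hr, e⟩
      · obtain ⟨r, hr, e⟩ := ih _ (weight_swapAt_lt hlt) h2 rfl
        have hs := reach_piSucc k hk s
        rw [piSucc, if_pos hlt] at hs
        exact ⟨r, hs.trans hr, e⟩

theorem below_of_reach {s r : Rook n} (h : Reach s r) : Below r.triple s := by
  obtain ⟨⟨m, hm⟩, rfl⟩ := h
  change Below (m.unop s).triple s
  induction hm using Submonoid.closure_induction generalizing s with
  | mem f hf =>
    rcases hf with rfl | ⟨k, hk, rfl⟩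
    · exact s.below_piZero
    · change Below (piSucc k hk s).triple s
      unfold piSucc
      split_ifs with hlt
      · exact below_swapAt hlt
      · exact Below.refl s
  | one => exact Below.refl s
  | mul f g _ _ ihf ihg => exact (ihg (s := f.unop s)).trans ihf

/-- The `R`-order in terms of rook triples. -/
theorem reach_iff_below {s r : Rook n} : Reach s r ↔ Below r.triple s := by
  refine ⟨below_of_reach, fun h => ?_⟩
  obtain ⟨r', hr', e⟩ := h.exists_reach r.isRookTriple_triple
  exact triple_injective e ▸ hr'

theorem Reach.antisymm {s r : Rook n} (h : Reach s r) (h' : Reach r s) : s = r := by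
  have h1 := below_of_reach h
  have h2 := below_of_reach h'
  have hS : s.supp = r.supp := subset_antisymm h2.subset h1.subset
  refine triple_injective (Triple.ext hS ?_ ?_)
  · ext ⟨b, a⟩
    exact ⟨fun hba => (h1.inv b a hba (hS.le (Inv_subset hba).1)).2,
      fun hba => (h2.inv b a hba (hS.ge (Inv_subset hba).1)).2⟩
  · funext x
    by_cases hx : x ∈ s.supp
    · exact le_antisymm (h1.zeros_le x (hS.le hx)) (h2.zeros_le x hx)
    · exact (zeros_of_notMem hx).trans (zeros_of_notMem (hS ▸ hx)).symm

/-! ### Left operators -/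

/-- Left action of `π₀`: replace the letter `1` by `0`. -/
def leftZero (s : Rook n) : Rook n where
  letter i := if s.letter i = 1 then 0 else s.letter i
  le i := by
    split
    · exact Nat.zero_le n
    · exact s.le i
  inj i j h hi := by
    by_cases h0 : s.letter i = 1
    · simp [h0] at hi
    · by_cases h1 : s.letter j = 1
      · simp [h0, h1] at h hi
        exact absurd h hi
      · simp only [h0, h1, if_false] at h hi
        exact s.inj i j h hi

/-- Exchange the letters `k` and `k + 1`. -/
def swapLetters (k : ℕ) (hk : k ≠ 0) (hn : k + 1 ≤ n) (s : Rook n) : Rook n where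
  letter i := Equiv.swap k (k + 1) (s.letter i)
  le i := by
    have := s.le i
    rw [Equiv.swap_apply_def]
    split_ifs <;> omega
  inj i j h hi := by
    refine s.inj i j ((Equiv.swap k (k + 1)).injective h) fun h0 => hi ?_
    rw [h0, Equiv.swap_apply_of_ne_of_ne hk.symm (by omega)]

/-- The letter `k + 1` occurs in `s`, and the letter `k` does not occur after it. -/
def Ascends (k : ℕ) (s : Rook n) : Prop :=
  ∃ j, s.letter j = k + 1 ∧ ∀ i, s.letter i = k → i < j

open Classical in
/-- Left action of `π_k`: exchange the letters `k` and `k + 1` if `k + 1` occurs and `k` does not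
occur after it.  It is the right action on the transposed rook matrix. -/
noncomputable def leftSucc (k : ℕ) (hk : k ≠ 0) (hn : k + 1 ≤ n) (s : Rook n) : Rook n :=
  if Ascends k s then swapLetters k hk hn s else s

theorem leftZero_piZero (s : Rook n) : s.leftZero.piZero = s.piZero.leftZero := by
  ext i
  simp only [leftZero, piZero]
  split_ifs <;> simp_all

theorem leftZero_piSucc (k : ℕ) (hk : k + 1 < n) (s : Rook n) :
    piSucc k hk s.leftZero = (piSucc k hk s).leftZero := by
  by_cases hlt : s.leftZero.letter ⟨k, Nat.lt_of_succ_lt hk⟩ < s.leftZero.letter ⟨k + 1, hk⟩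
  · have hlt' : s.letter ⟨k, Nat.lt_of_succ_lt hk⟩ < s.letter ⟨k + 1, hk⟩ := by
      simp only [leftZero] at hlt
      split_ifs at hlt <;> omega
    rw [piSucc, piSucc, if_pos hlt, if_pos hlt']
    rfl
  · by_cases hlt' : s.letter ⟨k, Nat.lt_of_succ_lt hk⟩ < s.letter ⟨k + 1, hk⟩
    · -- the letters are `0` and `1`
      rw [piSucc, piSucc, if_neg hlt, if_pos hlt']
      have h01 : s.letter ⟨k, Nat.lt_of_succ_lt hk⟩ = 0 ∧ s.letter ⟨k + 1, hk⟩ = 1 := by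
        simp only [leftZero] at hlt
        split_ifs at hlt <;> omega
      ext i
      simp only [leftZero, swapAt, Equiv.swap_apply_def]
      split_ifs <;> simp_all
    · rw [piSucc, piSucc, if_neg hlt, if_neg hlt']

theorem ascends_swapAt {k j : ℕ} {hj : j + 1 < n} {s : Rook n}
    (hlt : s.letter ⟨j, Nat.lt_of_succ_lt hj⟩ < s.letter ⟨j + 1, hj⟩)
    (hne : ¬ (s.letter ⟨j, Nat.lt_of_succ_lt hj⟩ = k ∧ s.letter ⟨j + 1, hj⟩ = k + 1)) :
    Ascends k (swapAt j hj s) ↔ Ascends k s := by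
  unfold Ascends
  rw [(adj j hj).surjective.exists]
  refine exists_congr fun p => ?_
  rw [(adj j hj).surjective.forall]
  simp only [swapAt_letter_adj]
  refine and_congr_right fun hp => forall_congr' fun i => imp_congr_right fun hi => ?_
  rw [adj_lt_adj]
  constructor
  · rintro (h | ⟨h1, h2⟩)
    · exact h.1
    · obtain rfl : i = ⟨j + 1, hj⟩ := Fin.ext h1
      obtain rfl : p = ⟨j, Nat.lt_of_succ_lt hj⟩ := Fin.ext h2
      omega
  · refine fun h => Or.inl ⟨h, ?_⟩
    rintro ⟨h1, h2⟩
    obtain rfl : i = ⟨j, Nat.lt_of_succ_lt hj⟩ := Fin.ext h1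
    obtain rfl : p = ⟨j + 1, hj⟩ := Fin.ext h2
    exact hne ⟨hi, hp⟩

theorem leftSucc_piSucc (k : ℕ) (hk : k ≠ 0) (hn : k + 1 ≤ n) (j : ℕ) (hj : j + 1 < n)
    (s : Rook n) : piSucc j hj (leftSucc k hk hn s) = leftSucc k hk hn (piSucc j hj s) := by
  by_cases hpair : s.letter ⟨j, Nat.lt_of_succ_lt hj⟩ = k ∧ s.letter ⟨j + 1, hj⟩ = k + 1
  · -- both operators exchange the same two letters
    obtain ⟨h1, h2⟩ := hpair
    have hasc : Ascends k s := by
      refine ⟨_, h2, fun i hi => ?_⟩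
      obtain rfl := s.inj _ _ (hi.trans h1.symm) (by omega)
      simp [Fin.lt_def]
    have hnasc : ¬ Ascends k (swapAt j hj s) := by
      rintro ⟨p, hp, hlt⟩
      have hp' : (swapAt j hj s).letter (adj j hj ⟨j + 1, hj⟩) = k + 1 := by
        rw [swapAt_letter_adj, h2]
      obtain rfl := (swapAt j hj s).inj _ _ (hp.trans hp'.symm) (by omega)
      have := hlt (adj j hj ⟨j, Nat.lt_of_succ_lt hj⟩) (by rw [swapAt_letter_adj, h1])
      rw [adj_left, adj_right] at this
      simp [Fin.lt_def] at this
    have e1 : piSucc j hj s = swapAt j hj s := by rw [piSucc, if_pos (by omega)]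
    rw [leftSucc, leftSucc, if_pos hasc, e1, if_neg hnasc, piSucc, if_neg]
    · ext i
      simp only [swapLetters, swapAt]
      by_cases hi1 : i = ⟨j, Nat.lt_of_succ_lt hj⟩
      · rw [hi1, Equiv.swap_apply_left, h1, h2, Equiv.swap_apply_left]
      · by_cases hi2 : i = ⟨j + 1, hj⟩
        · rw [hi2, Equiv.swap_apply_right, h1, h2, Equiv.swap_apply_right]
        · rw [Equiv.swap_apply_of_ne_of_ne hi1 hi2, Equiv.swap_apply_of_ne_of_ne]
          · exact fun e => hi1 (s.inj _ _ (e.trans h1.symm) (by omega))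
          · exact fun e => hi2 (s.inj _ _ (e.trans h2.symm) (by omega))
    · simp [swapLetters, h1, h2]
  · have hasc : Ascends k (piSucc j hj s) ↔ Ascends k s := by
      unfold piSucc
      split_ifs with hlt
      · exact ascends_swapAt hlt hpair
      · rfl
    by_cases h : Ascends k s
    · rw [leftSucc, leftSucc, if_pos h, if_pos (hasc.2 h)]
      have hrev : ¬ (s.letter ⟨j, Nat.lt_of_succ_lt hj⟩ = k + 1 ∧
          s.letter ⟨j + 1, hj⟩ = k) := by
        rintro ⟨h1, h2⟩
        obtain ⟨p, hp, hlt⟩ := h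
        obtain rfl := s.inj _ _ (hp.trans h1.symm) (by omega)
        have := hlt _ h2
        simp [Fin.lt_def] at this
      have hiff : (swapLetters k hk hn s).letter ⟨j, Nat.lt_of_succ_lt hj⟩ <
          (swapLetters k hk hn s).letter ⟨j + 1, hj⟩ ↔
          s.letter ⟨j, Nat.lt_of_succ_lt hj⟩ < s.letter ⟨j + 1, hj⟩ := by
        simp only [swapLetters, Equiv.swap_apply_def]
        split_ifs <;> omega
      unfold piSucc
      simp only [hiff]
      split_ifs
      · rfl
      · rfl
    · rw [leftSucc, leftSucc, if_neg h, if_neg (fun h' => h (hasc.1 h'))]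

theorem leftSucc_piZero (k : ℕ) (hk : k ≠ 0) (hn : k + 1 ≤ n) (s : Rook n) :
    (leftSucc k hk hn s).piZero = leftSucc k hk hn s.piZero := by
  have hswap : (swapLetters k hk hn s).piZero = swapLetters k hk hn s.piZero := by
    ext i
    simp only [piZero, swapLetters]
    split_ifs
    · rw [Equiv.swap_apply_of_ne_of_ne hk.symm (by omega)]
    · rfl
  by_cases h : Ascends k s
  · rw [leftSucc, leftSucc, if_pos h, hswap]
    split_ifs with h'
    · rfl
    · -- the letter `k + 1` is the first one and `k` is absent
      obtain ⟨p, hp, hlt⟩ := h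
      have hp0 : p.val = 0 := by
        by_contra hp0
        refine h' ⟨p, by rw [piZero_letter_of_pos hp0, hp], fun i hi => hlt i ?_⟩
        rw [← piZero_letter_of_pos (s := s) (i := i), hi]
        exact fun hi0 => hk (by rw [← hi, piZero_letter_zero hi0])
      ext i
      by_cases hi : i.val = 0
      · simp [swapLetters, piZero_letter_zero hi, Equiv.swap_apply_of_ne_of_ne hk.symm]
      · simp only [swapLetters, piZero_letter_of_pos hi]
        rw [Equiv.swap_apply_of_ne_of_ne]
        · intro e
          have := hlt i e
          rw [Fin.lt_def] at this
          omega
        · intro e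
          obtain rfl := s.inj _ _ (e.trans hp.symm) (by omega)
          exact hi hp0
  · rw [leftSucc, leftSucc, if_neg h, if_neg]
    rintro ⟨p, hp, hlt⟩
    have hp0 : p.val ≠ 0 := fun hp0 => by simp [piZero_letter_zero hp0] at hp
    rw [piZero_letter_of_pos hp0] at hp
    refine h ⟨p, hp, fun i hi => ?_⟩
    by_cases hi0 : i.val = 0
    · rw [Fin.lt_def]
      omega
    · exact hlt i (by rw [piZero_letter_of_pos hi0, hi])

/-- An operator that commutes with the generators commutes with the whole right action. -/
theorem act_comm {L : Rook n → Rook n} (h0 : ∀ s, (L s).piZero = L s.piZero)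
    (h1 : ∀ k hk s, piSucc k hk (L s) = L (piSucc k hk s)) (s : Rook n) (x : zeroRookMonoid n) :
    (L s).act x = L (s.act x) := by
  obtain ⟨m, hm⟩ := x
  change m.unop (L s) = L (m.unop s)
  induction hm using Submonoid.closure_induction generalizing s with
  | mem f hf =>
    rcases hf with rfl | ⟨k, hk, rfl⟩
    · exact h0 s
    · exact h1 k hk s
  | one => rfl
  | mul f g _ _ ihf ihg =>
    change g.unop (f.unop (L s)) = L (g.unop (f.unop s))
    rw [ihf, ihg]

theorem swapLetters_swapLetters (k : ℕ) (hk : k ≠ 0) (hn : k + 1 ≤ n) (s : Rook n) :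
    swapLetters k hk hn (swapLetters k hk hn s) = s := by
  ext i
  simp [swapLetters]

/-- Every rook except the identity is the image of a rook of larger weight under a left
operator. -/
theorem exists_left_preimage {s : Rook n} (hs : s ≠ idRook n) :
    (∃ r : Rook n, s.weight < r.weight ∧ r.leftZero = s) ∨
      ∃ (r : Rook n) (k : ℕ) (hk : k ≠ 0) (hn : k + 1 ≤ n),
        s.weight < r.weight ∧ leftSucc k hk hn r = s := by
  -- first case: `k` occurs and `k + 1` does not occur after it
  by_cases hdesc : ∃ (k : ℕ) (_ : k ≠ 0) (_ : k + 1 ≤ n) (j : Fin n),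
      s.letter j = k ∧ ∀ i, s.letter i = k + 1 → i < j
  · obtain ⟨k, hk, hn, j, hj, hlt⟩ := hdesc
    refine Or.inr ⟨swapLetters k hk hn s, k, hk, hn, ?_, ?_⟩
    · by_cases hex : ∃ i, s.letter i = k + 1
      · obtain ⟨i, hi⟩ := hex
        refine weight_lt_of_exchange (hlt i hi) ?_ ?_ ?_ fun l h1 h2 => ?_
        · simp [swapLetters, hi, hj]
        · simp [swapLetters, hi, hj]
        · simp [swapLetters, hi, hj]
        · simp only [swapLetters]
          rw [Equiv.swap_apply_of_ne_of_ne]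
          · exact fun e => h2 (s.inj _ _ (e.trans hj.symm) (by omega))
          · exact fun e => h1 (s.inj _ _ (e.trans hi.symm) (by omega))
      · push Not at hex
        refine weight_lt_of_le (fun l => ?_) fun e => ?_
        · have := hex l
          simp only [swapLetters, Equiv.swap_apply_def]
          split_ifs <;> omega
        · have : s.letter j = (swapLetters k hk hn s).letter j := congrArg (fun t => t.letter j) e
          simp [swapLetters, hj] at this
    · rw [leftSucc, if_pos, swapLetters_swapLetters]
      refine ⟨j, by simp [swapLetters, hj], fun i hi => hlt i ?_⟩
      have := congrArg (Equiv.swap k (k + 1)) hi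
      simpa [swapLetters] using this
  -- second case: `1` does not occur
  by_cases hone : ∃ i, s.letter i = 1
  · -- otherwise all letters occur, in increasing order
    exfalso
    push Not at hdesc
    have hall : ∀ m, m < n → ∃ i, s.letter i = m + 1 := by
      intro m
      induction m with
      | zero => exact fun _ => hone
      | succ m ih =>
        intro hm
        obtain ⟨j, hj⟩ := ih (by omega)
        obtain ⟨i, hi, -⟩ := hdesc (m + 1) (by omega) (by omega) j hj
        exact ⟨i, hi⟩
    choose p hp using fun m : Fin n => hall m.val m.isLt
    have hstep : ∀ m (hm : m + 1 < n), p ⟨m, by omega⟩ < p ⟨m + 1, hm⟩ := by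
      intro m hm
      obtain ⟨i, hi, hji⟩ := hdesc (m + 1) (by omega) (by omega) _ (hp ⟨m, by omega⟩)
      have hpi := hp ⟨m + 1, hm⟩
      obtain rfl := s.inj _ _ (hi.trans hpi.symm) (by omega)
      refine lt_of_le_of_ne hji fun e => ?_
      have := hp ⟨m, by omega⟩
      rw [e, hpi] at this
      simp at this
    have hmono : StrictMono p := by
      cases n with
      | zero => exact fun i => i.elim0
      | succ n => exact Fin.strictMono_iff_lt_succ.2 fun i => hstep i.val (by omega)
    have hpid : p = id := by
      refine (hmono.range_inj strictMono_id).1 ?_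
      rw [(Finite.injective_iff_surjective.1 hmono.injective).range_eq, Set.range_id]
    refine hs (Rook.ext (funext fun i => ?_))
    have := hp i
    rwa [hpid] at this
  · left
    push Not at hone
    -- by the pigeonhole principle some letter is `0`
    obtain ⟨i, hi⟩ : ∃ i, s.letter i = 0 := by
      by_contra! hpos
      let f : Fin n → Fin n := fun i => ⟨s.letter i - 1, by have := s.le i; have := hpos i; omega⟩
      have hf : Function.Injective f := by
        intro i j hij
        refine s.inj i j ?_ (hpos i)
        have h1 : s.letter i - 1 = s.letter j - 1 := congrArg Fin.val hij
        have := hpos i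
        have := hpos j
        omega
      have hn : 0 < n := by
        refine Nat.pos_of_ne_zero fun h0 => hs ?_
        subst h0
        exact Rook.ext (funext fun i => i.elim0)
      obtain ⟨i, hi⟩ := Finite.injective_iff_surjective.1 hf ⟨0, hn⟩
      have h1 : s.letter i - 1 = 0 := congrArg Fin.val hi
      have := hpos i
      exact hone i (by omega)
    let r : Rook n :=
      { letter := fun l => if l = i then 1 else s.letter l
        le := fun l => by
          split
          · exact i.pos
          · exact s.le l
        inj := fun l m h h0 => by
          have := hone l
          have := hone m
          by_cases hl : l = i
          · by_cases hm : m = i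
            · rw [hl, hm]
            · simp only [hl, hm, if_true, if_false] at h
              omega
          · by_cases hm : m = i
            · simp only [hl, hm, if_true, if_false] at h
              omega
            · simp only [hl, hm, if_false] at h h0
              exact s.inj l m h h0 }
    have hr : r.leftZero = s := by
      ext l
      have := hone l
      simp only [leftZero, r]
      by_cases hl : l = i
      · simp [hl, hi]
      · simp [hl, this]
    refine ⟨r, weight_lt_of_le (fun l => ?_) fun e => ?_, hr⟩
    · simp only [r]
      split_ifs with hl
      · rw [hl, hi]
        exact Nat.zero_le 1
      · exact le_rfl
    · have : s.letter i = r.letter i := congrArg (fun t => t.letter i) e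
      simp [r, hi] at this

/-- The action of an element on all rooks is determined by its action on the identity, because
every rook is the image of the identity under operators that commute with the right action. -/
theorem act_eq_of_act_idRook {x y : zeroRookMonoid n} (h : (idRook n).act x = (idRook n).act y)
    (s : Rook n) : s.act x = s.act y := by
  induction hw : n * (n * n) - s.weight using Nat.strong_induction_on generalizing s with
  | _ w ih =>
    subst hw
    by_cases hs : s = idRook n
    · rw [hs, h]
    · rcases exists_left_preimage hs with ⟨r, hr, rfl⟩ | ⟨r, k, hk, hn, hr, rfl⟩
      · rw [act_comm leftZero_piZero leftZero_piSucc, act_comm leftZero_piZero leftZero_piSucc,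
          ih _ (by have := r.weight_le; omega) r rfl]
      · rw [act_comm (leftSucc_piZero k hk hn) (leftSucc_piSucc k hk hn),
          act_comm (leftSucc_piZero k hk hn) (leftSucc_piSucc k hk hn),
          ih _ (by have := r.weight_le; omega) r rfl]

/-! ### The meet triple -/

theorem meetI₀_trans {u v : Rook n} {c b a : ℕ} (h1 : (c, b) ∈ meetI₀ u v)
    (h2 : (b, a) ∈ meetI₀ u v) : (c, a) ∈ meetI₀ u v :=
  Relation.TransGen.trans (r := fun b a => (b, a) ∈ u.Inv ∪ v.Inv) h1 h2

theorem subset_meetI₀ {u v : Rook n} {b a : ℕ} (h : (b, a) ∈ u.Inv ∪ v.Inv) :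
    (b, a) ∈ meetI₀ u v :=
  Relation.TransGen.single (r := fun b a => (b, a) ∈ u.Inv ∪ v.Inv) h

/-- Induction over a chain of inversions, adding links at the large end. -/
theorem meetI₀_induction {u v : Rook n} {a : ℕ} {P : ℕ → Prop}
    (single : ∀ b, (b, a) ∈ u.Inv ∪ v.Inv → P b)
    (cons : ∀ c b, (c, b) ∈ u.Inv ∪ v.Inv → (b, a) ∈ meetI₀ u v → P b → P c) {b : ℕ}
    (h : (b, a) ∈ meetI₀ u v) : P b :=
  Relation.TransGen.head_induction_on (r := fun b a => (b, a) ∈ u.Inv ∪ v.Inv)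
    (motive := fun b _ => P b) h (fun {b} hb => single b hb) fun {c b} hc hb => cons c b hc hb

theorem lt_of_mem_union_Inv {u v : Rook n} {b a : ℕ} (h : (b, a) ∈ u.Inv ∪ v.Inv) : a < b :=
  h.elim (fun h => (Inv_subset h).2.2) fun h => (Inv_subset h).2.2

theorem lt_of_mem_meetI₀ {u v : Rook n} {b a : ℕ} (h : (b, a) ∈ meetI₀ u v) : a < b :=
  meetI₀_induction (P := fun b => a < b) (fun _ => lt_of_mem_union_Inv)
    (fun _ _ h _ ih => ih.trans (lt_of_mem_union_Inv h)) h

theorem isGreatest_meetS (u v : Rook n) : IsGreatest (meetCandidates u v) (meetS u v) := by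
  refine ⟨⟨Set.sUnion_subset fun T hT => hT.1, ?_⟩, fun T hT => Set.subset_sUnion_of_mem hT⟩
  rintro b a hba ⟨T, hT, hb⟩
  exact ⟨T, hT, hT.2 b a hba hb⟩

theorem meetS_subset {u v : Rook n} {x : ℕ} (hx : x ∈ meetS u v) : x ∈ u.supp ∧ x ∈ v.supp :=
  (isGreatest_meetS u v).1.1 hx

theorem meetS_compatible {u v : Rook n} {b a : ℕ} (h : (b, a) ∈ meetI₀ u v)
    (hb : b ∈ meetS u v) : a ∈ meetS u v :=
  (isGreatest_meetS u v).1.2 b a h hb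

theorem mem_meetI_of_mem_meetI₀ {u v : Rook n} {b a : ℕ} (h : (b, a) ∈ meetI₀ u v)
    (hb : b ∈ meetS u v) : (b, a) ∈ meetI u v :=
  ⟨h, hb, meetS_compatible h hb⟩

theorem meetI_trans {u v : Rook n} {c b a : ℕ} (h1 : (c, b) ∈ meetI u v)
    (h2 : (b, a) ∈ meetI u v) : (c, a) ∈ meetI u v :=
  ⟨meetI₀_trans h1.1 h2.1, h1.2.1, h2.2.2⟩

/-- A letter between the two ends of a chain of inversions is split by the link that jumps over
it, because the set of inversions of a rook is cotransitive. -/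
theorem meetI₀_cotrans {u v : Rook n} {c b a : ℕ} (h : (c, a) ∈ meetI₀ u v)
    (hu : b ∈ u.supp) (hv : b ∈ v.supp) (hab : a < b) (hbc : b < c) :
    (c, b) ∈ meetI₀ u v ∨ (b, a) ∈ meetI₀ u v := by
  have link : ∀ {c d}, (c, d) ∈ u.Inv ∪ v.Inv → d < b → b < c →
      (c, b) ∈ meetI₀ u v ∨ (b, d) ∈ meetI₀ u v := by
    rintro c d (h | h) hd hc
    · exact (Inv_cotrans h hu hd hc).imp (fun h => subset_meetI₀ (Or.inl h))
        fun h => subset_meetI₀ (Or.inl h)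
    · exact (Inv_cotrans h hv hd hc).imp (fun h => subset_meetI₀ (Or.inr h))
        fun h => subset_meetI₀ (Or.inr h)
  refine meetI₀_induction (P := fun c => b < c → (c, b) ∈ meetI₀ u v ∨ (b, a) ∈ meetI₀ u v)
    (fun c hc hbc => link hc hab hbc) (fun c d hcd hda ih hbc => ?_) h hbc
  rcases lt_trichotomy b d with hd | rfl | hd
  · exact (ih hd).imp_left (meetI₀_trans (subset_meetI₀ hcd))
  · exact Or.inl (subset_meetI₀ hcd)
  · exact (link hcd hd hbc).imp_right fun h => meetI₀_trans h hda

theorem isGreatest_meetZ {u v : Rook n} {x : ℕ} (hx : x ∈ meetS u v) :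
    IsGreatest (meetZSet u v x) ((meetTriple u v).Z x) := by
  have hZ : (meetTriple u v).Z x = sSup (meetZSet u v x) := if_pos hx
  have hbdd : BddAbove (meetZSet u v x) := by
    refine ⟨n, ?_⟩
    rintro z ⟨i, -, rfl | rfl⟩
    · have := u.zeros_add_ncard_supp_le i
      omega
    · have := v.zeros_add_ncard_supp_le i
      omega
  rw [hZ]
  exact ⟨Nat.sSup_mem ⟨_, x, Or.inl rfl, Or.inl rfl⟩ hbdd, fun z hz => le_csSup hbdd hz⟩

theorem meetZ_le_iff {u v : Rook n} {x m : ℕ} (hx : x ∈ meetS u v) :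
    (meetTriple u v).Z x ≤ m ↔
      ∀ i, (i = x ∨ (x, i) ∈ meetI u v) → u.zeros i ≤ m ∧ v.zeros i ≤ m := by
  rw [isLUB_le_iff (isGreatest_meetZ hx).isLUB]
  constructor
  · exact fun h i hi => ⟨h ⟨i, hi, Or.inl rfl⟩, h ⟨i, hi, Or.inr rfl⟩⟩
  · rintro h z ⟨i, hi, rfl | rfl⟩
    · exact (h i hi).1
    · exact (h i hi).2

theorem isRookTriple_meetTriple (u v : Rook n) : IsRookTriple n (meetTriple u v) where
  mem b a h := ⟨h.2.1, h.2.2, lt_of_mem_meetI₀ h.1⟩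
  trans _ _ _ := meetI_trans
  cotrans c b a h hb hab hbc := by
    have hb' := meetS_subset hb
    exact (meetI₀_cotrans h.1 hb'.1 hb'.2 hab hbc).imp
      (fun h' => mem_meetI_of_mem_meetI₀ h' h.2.1) fun h' => mem_meetI_of_mem_meetI₀ h' hb
  zeros_le x hx := by
    obtain ⟨i, -, hi⟩ := (isGreatest_meetZ hx).1
    have hu : (meetS u v).ncard ≤ u.supp.ncard :=
      Set.ncard_le_ncard (fun y hy => (meetS_subset hy).1) u.finite_supp
    have hv : (meetS u v).ncard ≤ v.supp.ncard :=
      Set.ncard_le_ncard (fun y hy => (meetS_subset hy).2) v.finite_supp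
    have h1 := u.zeros_add_ncard_supp_le i
    have h2 := v.zeros_add_ncard_supp_le i
    change _ + (meetS u v).ncard ≤ n
    rcases hi with hi | hi <;> omega
  zeros_off x hx := if_neg hx
  zeros_inv b a h := by
    rw [meetZ_le_iff h.2.2]
    rintro i hi
    refine (meetZ_le_iff h.2.1).1 le_rfl i (Or.inr ?_)
    rcases hi with rfl | hi
    · exact h
    · exact meetI_trans h hi
  zeros_noninv b a hb ha hab hnot := by
    have hZa := (meetZ_le_iff (x := a) ha).1 le_rfl
    -- a letter `i > a` not inverted with `a` comes after `a` in both rooks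
    have hlarge : ∀ i, i ∈ meetS u v → a < i → (i, a) ∉ meetI u v →
        u.zeros i ≤ (meetTriple u v).Z a ∧ v.zeros i ≤ (meetTriple u v).Z a := by
      intro i hi hai hnot
      have h := hZa a (Or.inl rfl)
      have hn : (i, a) ∉ u.Inv ∪ v.Inv := fun h' =>
        hnot (mem_meetI_of_mem_meetI₀ (subset_meetI₀ h') hi)
      exact ⟨(zeros_le_of_notMem_Inv (meetS_subset hi).1 (meetS_subset ha).1 hai
          fun h' => hn (Or.inl h')).trans h.1,
        (zeros_le_of_notMem_Inv (meetS_subset hi).2 (meetS_subset ha).2 hai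
          fun h' => hn (Or.inr h')).trans h.2⟩
    rw [meetZ_le_iff hb]
    rintro i (rfl | hi)
    · exact hlarge i hb hab hnot
    · rcases lt_trichotomy i a with hia | rfl | hia
      · -- cotransitivity on `i < a < b`
        have ha' := meetS_subset ha
        rcases meetI₀_cotrans hi.1 ha'.1 ha'.2 hia hab with h | h
        · exact absurd (mem_meetI_of_mem_meetI₀ h hb) hnot
        · exact hZa i (Or.inr (mem_meetI_of_mem_meetI₀ h ha))
      · exact absurd hi hnot
      · exact hlarge i hi.2.2 hia fun h => hnot (meetI_trans hi h)

theorem below_meetTriple_left (u v : Rook n) : Below (meetTriple u v) u where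
  subset _ hx := (meetS_subset hx).1
  inv b a hba hb := by
    have h := mem_meetI_of_mem_meetI₀ (subset_meetI₀ (v := v) (Or.inl hba)) hb
    exact ⟨h.2.2, h⟩
  zeros_le x hx := ((meetZ_le_iff hx).1 le_rfl x (Or.inl rfl)).1

theorem below_meetTriple_right (u v : Rook n) : Below (meetTriple u v) v where
  subset _ hx := (meetS_subset hx).2
  inv b a hba hb := by
    have h := mem_meetI_of_mem_meetI₀ (subset_meetI₀ (u := u) (Or.inr hba)) hb
    exact ⟨h.2.2, h⟩
  zeros_le x hx := ((meetZ_le_iff hx).1 le_rfl x (Or.inl rfl)).2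

/-- The triple of a common lower bound lies below the rook of the meet triple. -/
theorem Below.of_triple_eq_meetTriple {t u v r : Rook n} (hu : Below t.triple u)
    (hv : Below t.triple v) (hr : r.triple = meetTriple u v) : Below t.triple r := by
  -- a chain of inversions of `u` and `v` that starts in `t` stays in `t`
  have hchain : ∀ {b a}, (b, a) ∈ meetI₀ u v → b ∈ t.supp → (b, a) ∈ t.Inv := by
    intro b a h
    have link : ∀ {c d}, (c, d) ∈ u.Inv ∪ v.Inv → c ∈ t.supp → (c, d) ∈ t.Inv := by
      rintro c d (h | h) hc
      · exact (hu.inv c d h hc).2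
      · exact (hv.inv c d h hc).2
    refine meetI₀_induction (P := fun b => b ∈ t.supp → (b, a) ∈ t.Inv) (fun b h hb => link h hb)
      (fun c b h _ ih hc => ?_) h
    have h1 := link h hc
    exact Inv_trans h1 (ih (Inv_subset h1).2.1)
  have hS : r.supp = meetS u v := congrArg Triple.S hr
  have hI : r.Inv = meetI u v := congrArg Triple.I hr
  have hZ : r.zeros = (meetTriple u v).Z := congrArg Triple.Z hr
  have hsub : t.supp ⊆ meetS u v := (isGreatest_meetS u v).2
    ⟨fun x hx => ⟨hu.subset hx, hv.subset hx⟩, fun b a h hb => (Inv_subset (hchain h hb)).2.1⟩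
  refine ⟨hsub.trans hS.ge, fun b a hba hb => ?_, fun x hx => ?_⟩
  · rw [hI] at hba
    have h := hchain hba.1 hb
    exact ⟨(Inv_subset h).2.1, h⟩
  · rw [hZ, meetZ_le_iff (hsub hx)]
    rintro i (rfl | hi)
    · exact ⟨hu.zeros_le i hx, hv.zeros_le i hx⟩
    · have h := hchain hi.1 hx
      have hi' := (Inv_subset h).2.1
      have hle := zeros_le_of_mem_Inv h
      exact ⟨(hu.zeros_le i hi').trans hle, (hv.zeros_le i hi').trans hle⟩

/-- Meets for the orbit order: the meet triple is the triple of a rook, which is the greatest lower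
bound. -/
theorem exists_meet (u v : Rook n) :
    ∃ r : Rook n, r.triple = meetTriple u v ∧ Reach u r ∧ Reach v r ∧
      ∀ t, Reach u t → Reach v t → Reach r t := by
  obtain ⟨r, hu, hr⟩ := (below_meetTriple_left u v).exists_reach (isRookTriple_meetTriple u v)
  refine ⟨r, hr, hu, ?_, fun t htu htv => ?_⟩
  · rw [reach_iff_below, hr]
    exact below_meetTriple_right u v
  · rw [reach_iff_below] at *
    exact htu.of_triple_eq_meetTriple htv hr

/-! ### The bijection and the lattice -/

theorem below_idRook (r : Rook n) : Below r.triple (idRook n) := by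
  have hI : ∀ b a, (b, a) ∉ (idRook n).Inv := by
    intro b a h
    obtain ⟨i, j, hij, rfl, rfl, h1, -⟩ := mem_Inv.1 h
    simp only [idRook] at h1
    rw [Fin.lt_def] at hij
    omega
  refine ⟨?_, fun b a h => absurd h (hI b a), fun x _ => ?_⟩
  · rintro x ⟨h0, i, rfl⟩
    have := r.le i
    exact ⟨h0, ⟨r.letter i - 1, by omega⟩, by simp only [idRook]; omega⟩
  · have h0 : (idRook n).zeros x = 0 := by
      unfold zeros
      rw [Finset.card_eq_zero, Finset.filter_eq_empty_iff]
      rintro j - ⟨-, h, -⟩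
      simp [idRook] at h
    omega

/-- The bijection `x ↦ 1ₙ · x` between the `0`-rook monoid and the set of rooks. -/
noncomputable def actEquiv (n : ℕ) : zeroRookMonoid n ≃ Rook n :=
  Equiv.ofBijective (fun x => (idRook n).act x) ⟨fun x y h => by
      apply Subtype.ext
      apply MulOpposite.unop_injective
      funext s
      exact act_eq_of_act_idRook h s,
    fun r => reach_iff_below.2 r.below_idRook⟩

theorem actEquiv_mul (x m : zeroRookMonoid n) : actEquiv n (x * m) = (actEquiv n x).act m := rfl

theorem greenRLE_iff_reach {x y : zeroRookMonoid n} :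
    GreenRLE x y ↔ Reach (actEquiv n y) (actEquiv n x) := by
  constructor
  · intro h
    obtain ⟨m, hm⟩ := h ⟨1, mul_one x⟩
    exact ⟨m, by rw [← actEquiv_mul]; exact congrArg _ hm⟩
  · rintro ⟨m, hm⟩ _ ⟨z, rfl⟩
    rw [← actEquiv_mul] at hm
    obtain rfl := (actEquiv n).injective hm
    exact ⟨m * z, (mul_assoc y m z).symm⟩

end Rook

instance Rook.instFinite (n : ℕ) : Finite (Rook n) :=
  Finite.of_injective
    (fun (r : Rook n) (i : Fin n) => (⟨r.letter i, Nat.lt_succ_of_le (r.le i)⟩ : Fin (n + 1)))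
    fun _ _ h => Rook.ext (funext fun i => congrArg Fin.val (congrFun h i))

/-- Green's `R`-preorder on the `0`-rook monoid is an order: it corresponds to the orbit order on
rooks, which is antisymmetric. -/
noncomputable abbrev zeroRookPartialOrder (n : ℕ) : PartialOrder (zeroRookMonoid n) where
  le := GreenRLE
  le_refl _ := subset_rfl
  le_trans _ _ _ := Set.Subset.trans
  le_antisymm _ _ h h' := (Rook.actEquiv n).injective
    ((Rook.greenRLE_iff_reach.1 h').antisymm (Rook.greenRLE_iff_reach.1 h))

/-- A finite partial order with a greatest element in which any two elements have a greatest lower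
bound is a lattice: the join of two elements is the meet of their upper bounds. -/
theorem exists_lattice_of_isGLB {α : Type*} [Finite α] [P : PartialOrder α] (top : α)
    (htop : ∀ x, x ≤ top) (hmeet : ∀ x y : α, ∃ z, IsGLB {x, y} z) :
    ∃ L : Lattice α, L.toPartialOrder = P := by
  have hjoin : ∀ x y : α, ∃ z, IsLUB {x, y} z := by
    intro x y
    have hset : ∀ s : Set α, s.Finite → ∃ z, IsGLB s z := by
      intro s hs
      induction s, hs using Set.Finite.induction_on with
      | empty => exact ⟨top, isGLB_empty_iff.2 htop⟩
      | @insert a s _ _ ih =>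
        obtain ⟨z, hz⟩ := ih
        obtain ⟨w, hw⟩ := hmeet a z
        refine ⟨w, ?_⟩
        rw [isGLB_iff_le_iff] at hz hw ⊢
        intro b
        rw [hw b]
        simp only [lowerBounds_insert, lowerBounds_singleton, Set.mem_inter_iff, Set.mem_Iic]
        rw [hz b]
    obtain ⟨z, hz⟩ := hset (upperBounds {x, y}) (Set.toFinite _)
    exact ⟨z, isGLB_upperBounds.1 hz⟩
  choose inf hinf using hmeet
  choose sup hsup using hjoin
  exact ⟨{ P with
    inf := inf
    sup := sup
    le_sup_left := fun x y => (hsup x y).1 (by simp)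
    le_sup_right := fun x y => (hsup x y).1 (by simp)
    sup_le := fun x y z hx hy => (hsup x y).2 (by simp [hx, hy])
    inf_le_left := fun x y => (hinf x y).1 (by simp)
    inf_le_right := fun x y => (hinf x y).1 (by simp)
    le_inf := fun x y z hx hy => (hinf y z).2 (by simp [hx, hy]) }, rfl⟩

theorem mainTheorem4 (n : ℕ) :
    ∃ (e : zeroRookMonoid n ≃ Rook n) (_ : Lattice (zeroRookMonoid n)),
      -- the identification of the monoid with the set of rooks; `e.symm r` is `π_r`
      (∀ x, e x = (Rook.idRook n).act x) ∧
      -- the order of the lattice is Green's `R`-preorder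
      (∀ x y : zeroRookMonoid n, x ≤ y ↔ GreenRLE x y) ∧
      ∀ u v : Rook n,
        -- the largest compatible set and the maxima in the definition of the triple exist
        IsGreatest (Rook.meetCandidates u v) (Rook.meetTriple u v).S ∧
        (∀ x ∈ (Rook.meetTriple u v).S,
          IsGreatest (Rook.meetZSet u v x) ((Rook.meetTriple u v).Z x)) ∧
        -- the triple is the triple of exactly one rook, and this rook is the meet
        ∃ r : Rook n, r.triple = Rook.meetTriple u v ∧
          (∀ r' : Rook n, r'.triple = Rook.meetTriple u v → r' = r) ∧
          e.symm u ⊓ e.symm v = e.symm r := by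
  let e := Rook.actEquiv n
  let P := zeroRookPartialOrder n
  have hle : ∀ x y : zeroRookMonoid n, x ≤ y ↔ Rook.Reach (e y) (e x) :=
    fun x y => Rook.greenRLE_iff_reach
  have hGLB : ∀ u v r : Rook n, Rook.Reach u r → Rook.Reach v r →
      (∀ t, Rook.Reach u t → Rook.Reach v t → Rook.Reach r t) →
      IsGLB {e.symm u, e.symm v} (e.symm r) := by
    intro u v r hu hv ht
    rw [isGLB_iff_le_iff]
    intro b
    simp only [lowerBounds_insert, lowerBounds_singleton, Set.mem_inter_iff, Set.mem_Iic, hle,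
      Equiv.apply_symm_apply]
    exact ⟨fun h => ⟨hu.trans h, hv.trans h⟩, fun h => ht _ h.1 h.2⟩
  have : Finite (zeroRookMonoid n) := Finite.of_equiv _ e.symm
  obtain ⟨L, hL⟩ := exists_lattice_of_isGLB (1 : zeroRookMonoid n)
    (fun x => (hle _ _).2 ⟨x, by rw [← Rook.actEquiv_mul, one_mul]⟩) fun x y => by
      obtain ⟨r, -, hu, hv, ht⟩ := Rook.exists_meet (e x) (e y)
      have h := hGLB _ _ r hu hv ht
      rw [e.symm_apply_apply, e.symm_apply_apply] at h
      exact ⟨_, h⟩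
  have hLle : ∀ x y : zeroRookMonoid n, L.le x y ↔ P.le x y := by
    intro x y
    rw [← hL]
  refine ⟨e, L, fun _ => rfl, hLle, fun u v => ⟨Rook.isGreatest_meetS u v,
    fun x hx => Rook.isGreatest_meetZ hx, ?_⟩⟩
  obtain ⟨r, hr, hu, hv, ht⟩ := Rook.exists_meet u v
  refine ⟨r, hr, fun r' hr' => Rook.triple_injective (hr'.trans hr.symm), ?_⟩
  have h := hGLB u v r hu hv ht
  clear_value P
  subst hL
  exact isGLB_pair.unique h
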